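/- A Littlewood polynomial of degree $n$ is a polynomial $f(z)=a_0+a_1z+\dots+a_nz^n$ with all $a_i\in\{-1,1\}$, $0\le i\le n$. For such $f$ let $N(f)$ and $U(f)$ denote the numbers of complex zeros of $f$, counted with multiplicity, in the open disk $|z|<1$ and on the circle $|z|=1$, respectively. We say that $f$ realizes the pair $(k,n)$ if $f$ is a Littlewood polynomial of degree $n$ with $U(f)=0$ and $N(f)=k$; a pair $(k,n)$ with $1\le k\le n-1$ is Littlewood-admissible if some $f$ realizes it. The forward rotation of $f$ is $a_n+a_0z+a_1z^2+\dots+a_{n-1}z^n$, the backward rotation is the inverse operation $a_1+a_2z+\dots+a_nz^{n-1}+a_0z^n$, and the rotations of $f$ are the polynomials obtained by any number ($\ge 0$) of forward or of backward rotations. Define $$f_0(z)=1+z+z^2+z^3+z^4-z^5-z^6+z^7+z^8-z^9+z^{10}-z^{11}+z^{12},\qquad f_{j+1}(z)=f_j\bigl(z^{n_j+1}\bigr)f_j(z),\quad n_j=\deg f_j .$$ Theorem 5.7. Let $j\ge 0$ be an integer and $n=13^{2^j}-1$. Then $f_j$ is a Littlewood polynomial of degree $n$, and every pair $(k,n)$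 with $k$ a non-negative integer and $$\left|k-\frac n2\right|\le\left\lceil \frac{n^{0.43}}{2}\right\rceil-1$$ is Littlewood-admissible (in particular $1\le k\le n-1$) and is realized by some rotation of $f_j$. -/

import Mathlib

open Polynomial

noncomputable section

namespace LittlewoodRotation

/-- `f` is a Littlewood polynomial of degree `n`: `f = a_0 + a_1 z + ⋯ + a_n z ^ n` in `ℤ[z]`
with every `a_i` equal to `1` or `-1`. -/
def IsLittlewood (n : ℕ) (f : ℤ[X]) : Prop :=
  f.natDegree = n ∧ ∀ i ≤ n, f.coeff i = 1 ∨ f.coeff i = -1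

/-- `N(f)`: the number of complex zeros of `f` in the open unit disk, with multiplicity. -/
def numZerosInside (f : ℤ[X]) : ℕ :=
  (f.aroots ℂ).countP (fun z => ‖z‖ < 1)

/-- `U(f)`: the number of complex zeros of `f` on the unit circle, with multiplicity. -/
def numZerosOnCircle (f : ℤ[X]) : ℕ :=
  (f.aroots ℂ).countP (fun z => ‖z‖ = 1)

/-- `f` realizes the pair `(k, n)`: it is a Littlewood polynomial of degree `n` with exactly `k`
zeros in the open unit disk and none on the unit circle. -/
def Realizes (f : ℤ[X]) (k n : ℕ) : Prop :=
  IsLittlewood n f ∧ numZerosOnCircle f = 0 ∧ numZerosInside f = k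

/-- A pair `(k, n)` is valid when `1 ≤ k ≤ n - 1`. -/
def IsValidPair (k n : ℕ) : Prop :=
  1 ≤ k ∧ k + 1 ≤ n

/-- A valid pair `(k, n)` is Littlewood-admissible when some polynomial realizes it. -/
def LittlewoodAdmissible (k n : ℕ) : Prop :=
  IsValidPair k n ∧ ∃ f : ℤ[X], Realizes f k n

/-- Forward rotation: `a_0 + a_1 z + ⋯ + a_n z ^ n` becomes
`a_n + a_0 z + ⋯ + a_{n-1} z ^ n`, where `n` is the degree. -/
def rotForward (f : ℤ[X]) : ℤ[X] :=
  C (f.coeff f.natDegree) + ∑ i ∈ Finset.range f.natDegree, C (f.coeff i) * X ^ (i + 1)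

/-- Backward rotation: `a_0 + a_1 z + ⋯ + a_n z ^ n` becomes
`a_1 + a_2 z + ⋯ + a_n z ^ (n - 1) + a_0 z ^ n`, where `n` is the degree. -/
def rotBackward (f : ℤ[X]) : ℤ[X] :=
  (∑ i ∈ Finset.range f.natDegree, C (f.coeff (i + 1)) * X ^ i)
    + C (f.coeff 0) * X ^ f.natDegree

/-- The rotation of `f` by `m` steps: forward for `m ≥ 0`, backward for `m < 0`. -/
def rotate (f : ℤ[X]) : ℤ → ℤ[X]
  | Int.ofNat m => rotForward^[m] f
  | Int.negSucc m => rotBackward^[m + 1] f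

/-- The Barker polynomial of degree `12`. -/
def barker : ℤ[X] :=
  1 + X + X ^ 2 + X ^ 3 + X ^ 4 - X ^ 5 - X ^ 6 + X ^ 7 + X ^ 8 - X ^ 9 + X ^ 10 - X ^ 11 + X ^ 12

/-- The iterated products `f_0 = barker`, `f_{j+1}(z) = f_j(z ^ (n_j + 1)) * f_j(z)`, where
`n_j` is the degree of `f_j`. -/
def barkerIter : ℕ → ℤ[X]
  | 0 => barker
  | j + 1 => (barkerIter j).comp (X ^ ((barkerIter j).natDegree + 1)) * barkerIter j

end LittlewoodRotation

end

noncomputable section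

namespace LittlewoodRotation

/-! ### Counting zeros in the unit disk -/

/-! On the unit circle one rotation step changes `z * f(z)` by `±(z ^ (n + 1) - 1)`, of modulus at
most 2, so `m` forward steps stay within `2 * m` of `z ^ m * f`. If `|f| > 2 * m` there, Rouché
gives the rotated polynomial no zero on the circle and `N(f) + m` inside; backward steps remove
zeros likewise.

Two facts about `f_j` finish the proof. Skew-reciprocity pairs the zeros `w` and `-1 / w`, so
`N(f_j) = n / 2` (`two_mul_numZerosInside`). And `|f_j| ≥ (n + 1) ^ 0.43` on the circle
(`rpow_le_norm_aeval_barkerIter`): the bound is multiplicative along the recursion because powers of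
`z` stay on the circle, and for `f_0` it is an inequality in one real variable. So `m = |k - n / 2|`
steps are always affordable. -/

/-- A circle integral of `1 / (z - w)` counts whether `w` lies in the open unit disk. -/
lemma circleIntegral_one_div_sub {w : ℂ} (hw : ‖w‖ ≠ 1) :
    (∮ z in C(0, 1), 1 / (z - w)) = if ‖w‖ < 1 then 2 * Real.pi * Complex.I else 0 := by
  simp only [one_div]
  split_ifs with h
  · exact circleIntegral.integral_sub_inv_of_mem_ball (by simpa using h)
  · have h1 : 1 < ‖w‖ := lt_of_le_of_ne (not_lt.mp h) hw.symm
    have hne : ∀ z ∈ Metric.closedBall (0 : ℂ) 1, z - w ≠ 0 := by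
      intro z hz h0
      rw [sub_eq_zero.mp h0] at hz
      simp at hz
      linarith
    refine Complex.circleIntegral_eq_zero_of_differentiable_on_off_countable zero_le_one
      Set.countable_empty ?_ ?_
    · exact (continuousOn_id.sub continuousOn_const).inv₀ hne
    · intro z hz
      exact (differentiableAt_id.sub_const w).inv (hne z (Metric.ball_subset_closedBall hz.1))

lemma continuousOn_one_div_sub {w : ℂ} (hw : ‖w‖ ≠ 1) :
    ContinuousOn (fun z => 1 / (z - w)) (Metric.sphere (0 : ℂ) 1) := by
  refine continuousOn_const.div (continuousOn_id.sub continuousOn_const) ?_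
  intro z hz h0
  rw [← sub_eq_zero.mp h0] at hw
  exact hw (by simpa using hz)

lemma continuousOn_multiset_sum_one_div_sub (s : Multiset ℂ) (hs : ∀ w ∈ s, ‖w‖ ≠ 1) :
    ContinuousOn (fun z => (s.map fun w => 1 / (z - w)).sum) (Metric.sphere (0 : ℂ) 1) := by
  induction s using Multiset.induction with
  | empty => simpa using continuousOn_const
  | cons a s ih =>
    simp only [Multiset.map_cons, Multiset.sum_cons]
    exact (continuousOn_one_div_sub (hs a (by simp))).add (ih fun w hw => hs w (by simp [hw]))

lemma circleIntegral_multiset_sum_one_div_sub (s : Multiset ℂ) (hs : ∀ w ∈ s, ‖w‖ ≠ 1) :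
    (∮ z in C(0, 1), (s.map fun w => 1 / (z - w)).sum)
      = s.countP (fun w => ‖w‖ < 1) * (2 * Real.pi * Complex.I) := by
  induction s using Multiset.induction with
  | empty => simp [circleIntegral]
  | cons a s ih =>
    have ha : ‖a‖ ≠ 1 := hs a (by simp)
    have hs' : ∀ w ∈ s, ‖w‖ ≠ 1 := fun w hw => hs w (by simp [hw])
    simp only [Multiset.map_cons, Multiset.sum_cons]
    rw [circleIntegral.integral_add
      ((continuousOn_one_div_sub ha).circleIntegrable zero_le_one)
      ((continuousOn_multiset_sum_one_div_sub s hs').circleIntegrable zero_le_one),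
      circleIntegral_one_div_sub ha, ih hs', Multiset.countP_cons]
    split_ifs <;> push_cast <;> ring

lemma norm_ne_one_of_mem_roots {F : ℂ[X]} (hF : ∀ z : ℂ, ‖z‖ = 1 → F.eval z ≠ 0) :
    ∀ w ∈ F.roots, ‖w‖ ≠ 1 :=
  fun w hw h => hF w h (isRoot_of_mem_roots hw)

/-- The argument principle on the unit circle for polynomials. -/
lemma circleIntegral_derivative_div {F : ℂ[X]} (hF : ∀ z : ℂ, ‖z‖ = 1 → F.eval z ≠ 0) :
    (∮ z in C(0, 1), F.derivative.eval z / F.eval z)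
      = F.roots.countP (fun w => ‖w‖ < 1) * (2 * Real.pi * Complex.I) := by
  rw [← circleIntegral_multiset_sum_one_div_sub _ (norm_ne_one_of_mem_roots hF)]
  refine circleIntegral.integral_congr zero_le_one fun z hz => ?_
  exact (IsAlgClosed.splits F).eval_derivative_div_eval_of_ne_zero (hF z (by simpa using hz))

lemma circleIntegrable_derivative_div {F : ℂ[X]} (hF : ∀ z : ℂ, ‖z‖ = 1 → F.eval z ≠ 0) :
    CircleIntegrable (fun z => F.derivative.eval z / F.eval z) 0 1 :=
  ContinuousOn.circleIntegrable zero_le_one <|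
    F.derivative.continuous.continuousOn.div F.continuous.continuousOn
      fun z hz => hF z (by simpa using hz)

/-- **Rouché's theorem** on the unit circle for polynomials. -/
theorem countP_roots_eq_of_norm_sub_lt {F G : ℂ[X]}
    (h : ∀ z : ℂ, ‖z‖ = 1 → ‖F.eval z - G.eval z‖ < ‖F.eval z‖) :
    G.roots.countP (fun w => ‖w‖ < 1) = F.roots.countP (fun w => ‖w‖ < 1) := by
  have hF : ∀ z : ℂ, ‖z‖ = 1 → F.eval z ≠ 0 := fun z hz h0 => by
    have := h z hz
    rw [h0, norm_zero] at this
    exact absurd this (not_lt.mpr (norm_nonneg _))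
  have hG : ∀ z : ℂ, ‖z‖ = 1 → G.eval z ≠ 0 := fun z hz h0 => by
    have := h z hz
    rw [h0, sub_zero] at this
    exact lt_irrefl _ this
  have key : (∮ z in C(0, 1), (G.derivative.eval z / G.eval z
      - F.derivative.eval z / F.eval z)) = 0 := by
    refine circleIntegral.integral_eq_zero_of_hasDerivWithinAt
      (f := fun z => Complex.log (G.eval z / F.eval z)) zero_le_one fun z hz => ?_
    have hz1 : ‖z‖ = 1 := by simpa using hz
    have hF0 := hF z hz1
    have hG0 := hG z hz1
    -- The ratio lies within distance 1 of 1, so the principal logarithm is a primitive of the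
    -- difference of logarithmic derivatives.
    have hslit : G.eval z / F.eval z ∈ Complex.slitPlane := by
      apply Complex.ball_one_subset_slitPlane
      rw [mem_ball_iff_norm', one_sub_div hF0, norm_div, div_lt_one (norm_pos_iff.mpr hF0)]
      exact h z hz1
    refine ((((G.hasDerivAt z).div (F.hasDerivAt z) hF0).clog hslit).congr_deriv ?_).hasDerivWithinAt
    simp only [Pi.div_apply]
    field_simp
  rw [circleIntegral.integral_sub (circleIntegrable_derivative_div hG)
    (circleIntegrable_derivative_div hF), circleIntegral_derivative_div hF,
    circleIntegral_derivative_div hG, ← sub_mul] at key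
  have h2 := (mul_eq_zero.mp key).resolve_right Complex.two_pi_I_ne_zero
  exact_mod_cast sub_eq_zero.mp h2

lemma numZerosInside_eq_of_norm_sub_lt {F G : ℤ[X]}
    (h : ∀ z : ℂ, ‖z‖ = 1 → ‖aeval z F - aeval z G‖ < ‖aeval z F‖) :
    numZerosInside G = numZerosInside F :=
  countP_roots_eq_of_norm_sub_lt (by simpa [aeval_def, eval_map] using h)

lemma numZerosOnCircle_eq_zero {F : ℤ[X]} (h : ∀ z : ℂ, ‖z‖ = 1 → aeval z F ≠ 0) :
    numZerosOnCircle F = 0 := by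
  rw [numZerosOnCircle, Multiset.countP_eq_zero]
  intro w hw h1
  exact h w h1 (mem_aroots.mp hw).2

lemma numZerosInside_X_pow_mul {F : ℤ[X]} (hF : F ≠ 0) (m : ℕ) :
    numZerosInside (X ^ m * F) = m + numZerosInside F := by
  have : (X ^ m * F) ≠ 0 := mul_ne_zero (pow_ne_zero _ X_ne_zero) hF
  rw [numZerosInside, numZerosInside, aroots_mul this, aroots_X_pow, Multiset.countP_add]
  congr 1
  rw [Multiset.countP_nsmul]
  simp [← Multiset.cons_zero]

/-! ### Self-reciprocal symmetry -/

/-- Reversal is multiplicative over a domain and sends `X - a` to `1 - a * X`. Zero roots are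
excluded because reversal discards them. -/
lemma roots_reverse {K : Type*} [Field K] [IsAlgClosed K] {F : K[X]} (h0 : F.eval 0 ≠ 0) :
    F.reverse.roots = F.roots.map (·⁻¹) := by
  have key : ∀ s : Multiset K, (0 : K) ∉ s →
      ((s.map fun a => X - C a).prod.reverse).roots = s.map (·⁻¹) := by
    intro s hs
    induction s using Multiset.induction with
    | empty => rw [Multiset.map_zero, Multiset.prod_zero, ← C_1, reverse_C, roots_C, Multiset.map_zero]
    | cons a s ih =>
      have ha : a ≠ 0 := fun h => hs (by simp [h])
      have hs' : (0 : K) ∉ s := fun h => hs (by simp [h])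
      have hr : (X - C a : K[X]).reverse = C (-a) * X + C 1 := by
        have := reverse_add_C (X : K[X]) (-a)
        rw [C_neg, ← sub_eq_add_neg] at this
        rw [this, ← one_mul (X : K[X]), reverse_mul_X, ← C_1, reverse_C]
        simp [add_comm]
      have hne : (X - C a).reverse * (s.map fun a => X - C a).prod.reverse ≠ 0 := by
        refine mul_ne_zero (by simpa using X_sub_C_ne_zero a) ?_
        rw [Ne, reverse_eq_zero]
        exact (monic_multiset_prod_of_monic _ _ fun a _ => monic_X_sub_C a).ne_zero
      rw [Multiset.map_cons, Multiset.prod_cons, reverse_mul_of_domain, roots_mul hne, ih hs',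
        hr, roots_C_mul_X_add_C _ (neg_ne_zero.mpr ha)]
      simp [Multiset.singleton_add, inv_neg]
  have hF : F ≠ 0 := fun h => h0 (by simp [h])
  have h0' : (0 : K) ∉ F.roots := fun h => h0 (isRoot_of_mem_roots h)
  conv_lhs => rw [(IsAlgClosed.splits F).eq_prod_roots]
  rw [reverse_mul_of_domain, reverse_C, roots_C_mul _ (leadingCoeff_ne_zero.mpr hF), key _ h0']

/-- `f` is skew-reciprocal with respect to the degree `n`: `z ^ n f(1 / z) = f(-z)`. -/
def IsSkewReciprocal (n : ℕ) (f : ℤ[X]) : Prop :=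
  ∀ z : ℂ, z ≠ 0 → z ^ n * aeval z⁻¹ f = aeval (-z) f

/-- The zeros of a skew-reciprocal polynomial come in pairs `w`, `-1 / w`, so that half of them
lie in the unit disk if none is on the circle. -/
lemma two_mul_numZerosInside {f : ℤ[X]} {n : ℕ} (hn : f.natDegree = n) (hf : IsSkewReciprocal n f)
    (h0 : f.coeff 0 ≠ 0) (h1 : ∀ z : ℂ, ‖z‖ = 1 → aeval z f ≠ 0) :
    2 * numZerosInside f = n := by
  set F : ℂ[X] := f.map (algebraMap ℤ ℂ) with hFdef
  have hev : ∀ z, F.eval z = aeval z f := fun z => by rw [hFdef, eval_map, aeval_def]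
  have hF0 : F.eval 0 ≠ 0 := by
    rw [← coeff_zero_eq_eval_zero, hFdef, coeff_map]
    simpa using h0
  have hdeg : F.natDegree = n := by
    rw [hFdef, natDegree_map_eq_of_injective (RingHom.injective_int _), hn]
  have hrev : F.reverse = F.comp (-X) := by
    refine eq_of_infinite_eval_eq _ _ ((Set.finite_singleton (0 : ℂ)).infinite_compl.mono ?_)
    intro z hz
    have hz0 : z ≠ 0 := hz
    have hi : Invertible z⁻¹ := invertibleOfNonzero (inv_ne_zero hz0)
    have h := eval₂_reverse_mul_pow (RingHom.id ℂ) z⁻¹ F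
    simp only [invOf_eq_inv, inv_inv, hdeg, eval₂_id] at h
    have h2 := hf z hz0
    rw [← hev, ← hev, ← h] at h2
    simp only [Set.mem_ofPred_eq, eval_comp, eval_neg, eval_X, ← h2, inv_pow]
    field_simp
  have hroots : F.roots.map (·⁻¹) = F.roots.map fun x => -x := by
    rw [← roots_reverse hF0, hrev, roots_comp_neg_X]
  have hne := norm_ne_one_of_mem_roots (F := F) fun z hz => by rw [hev]; exact h1 z hz
  -- Counting members of modulus below 1: the inverted multiset counts zeros outside the disk, the
  -- negated one those inside.
  have hcount := congrArg (Multiset.countP fun w : ℂ => ‖w‖ < 1) hroots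
  rw [Multiset.countP_map, Multiset.countP_map, ← Multiset.countP_eq_card_filter,
    ← Multiset.countP_eq_card_filter] at hcount
  simp only [norm_neg, norm_inv] at hcount
  have hout : F.roots.countP (fun w => ‖w‖⁻¹ < 1) = F.roots.countP fun w => ¬ ‖w‖ < 1 := by
    refine Multiset.countP_congr rfl fun w hw => ?_
    have hw0 : w ≠ 0 := fun h => hF0 (by simpa [h] using isRoot_of_mem_roots hw)
    have hw1 := hne w hw
    rw [inv_lt_one₀ (norm_pos_iff.mpr hw0), not_lt]
    simp only [eq_iff_iff]
    exact ⟨le_of_lt, fun h => lt_of_le_of_ne h hw1.symm⟩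
  have hcard : Multiset.card F.roots = n := by
    rw [← hdeg]; exact (IsAlgClosed.splits F).natDegree_eq_card_roots.symm
  have hsplit := Multiset.card_eq_countP_add_countP (fun w : ℂ => ‖w‖ < 1) F.roots
  change 2 * F.roots.countP _ = n
  omega

/-! ### The iterated products of the Barker polynomial -/

lemma isLittlewood_barker : IsLittlewood 12 barker := by
  constructor
  · unfold barker
    compute_degree!
  · intro i hi
    interval_cases i <;> simp [barker, coeff_one, coeff_X]

lemma IsLittlewood.ne_zero {n : ℕ} {f : ℤ[X]} (hf : IsLittlewood n f) : f ≠ 0 := by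
  rintro rfl
  simpa using hf.2 0 (Nat.zero_le n)

lemma IsLittlewood.comp_mul {n : ℕ} {f : ℤ[X]} (hf : IsLittlewood n f) :
    IsLittlewood ((n + 1) ^ 2 - 1) (f.comp (X ^ (n + 1)) * f) := by
  rw [← expand_eq_comp_X_pow]
  have hpos : 0 < n + 1 := n.succ_pos
  have hne : expand ℤ (n + 1) f ≠ 0 := (expand_ne_zero hpos).mpr hf.ne_zero
  constructor
  · rw [natDegree_mul hne hf.ne_zero, natDegree_expand, hf.1]
    have : (n + 1) ^ 2 = n * (n + 1) + n + 1 := by ring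
    omega
  · intro i hi
    have hlt : i < (n + 1) * (n + 1) := by
      have : 0 < (n + 1) * (n + 1) := by positivity
      rw [pow_two] at hi
      omega
    have hq : i / (n + 1) ≤ n := Nat.lt_succ_iff.mp (Nat.div_lt_of_lt_mul hlt)
    have hr : i % (n + 1) ≤ n := Nat.lt_succ_iff.mp (Nat.mod_lt _ hpos)
    -- Uniqueness of base `n + 1` digits: a single term of the convolution survives.
    have hc : (expand ℤ (n + 1) f * f).coeff i
        = f.coeff (i / (n + 1)) * f.coeff (i % (n + 1)) := by
      rw [coeff_mul, Finset.sum_eq_single ((n + 1) * (i / (n + 1)), i % (n + 1))]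
      · rw [coeff_expand_mul' hpos]
      · rintro ⟨a, b⟩ hab hne'
        rw [Finset.HasAntidiagonal.mem_antidiagonal] at hab
        simp only at hab ⊢
        rw [coeff_expand hpos]
        split_ifs with hd
        · obtain ⟨c, rfl⟩ := hd
          by_cases hb : b ≤ n
          · refine absurd ?_ hne'
            have h1 : i / (n + 1) = c := by
              rw [← hab, Nat.mul_add_div hpos, Nat.div_eq_of_lt (Nat.lt_succ_of_le hb), add_zero]
            have h2 : i % (n + 1) = b := by
              rw [← hab, Nat.mul_add_mod, Nat.mod_eq_of_lt (Nat.lt_succ_of_le hb)]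
            rw [h1, h2]
          · rw [coeff_eq_zero_of_natDegree_lt (n := b) (by rw [hf.1]; omega), mul_zero]
        · rw [zero_mul]
      · intro h
        exact absurd (Finset.HasAntidiagonal.mem_antidiagonal.mpr (Nat.div_add_mod i (n + 1))) h
    rw [hc]
    rcases hf.2 _ hq with h1 | h1 <;> rcases hf.2 _ hr with h2 | h2 <;> simp [h1, h2]

lemma thirteen_pow_pos (j : ℕ) : 0 < 13 ^ 2 ^ j := by positivity

lemma isLittlewood_barkerIter (j : ℕ) : IsLittlewood (13 ^ 2 ^ j - 1) (barkerIter j) := by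
  induction j with
  | zero => simpa [barkerIter] using isLittlewood_barker
  | succ j ih =>
    have h := ih.comp_mul
    rw [Nat.sub_add_cancel (thirteen_pow_pos j), ← pow_mul, ← pow_succ] at h
    rwa [barkerIter, ih.1, Nat.sub_add_cancel (thirteen_pow_pos j)]

lemma aeval_barkerIter_succ (j : ℕ) (z : ℂ) :
    aeval z (barkerIter (j + 1))
      = aeval (z ^ 13 ^ 2 ^ j) (barkerIter j) * aeval z (barkerIter j) := by
  rw [barkerIter, (isLittlewood_barkerIter j).1, Nat.sub_add_cancel (thirteen_pow_pos j),
    map_mul, aeval_comp]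
  simp

lemma aeval_barker (z : ℂ) : aeval z barker =
    1 + z + z ^ 2 + z ^ 3 + z ^ 4 - z ^ 5 - z ^ 6 + z ^ 7 + z ^ 8 - z ^ 9 + z ^ 10 - z ^ 11
      + z ^ 12 := by
  simp [barker]

lemma isSkewReciprocal_barkerIter (j : ℕ) :
    IsSkewReciprocal (13 ^ 2 ^ j - 1) (barkerIter j) := by
  induction j with
  | zero =>
    intro z hz
    change z ^ 12 * aeval z⁻¹ barker = aeval (-z) barker
    rw [aeval_barker, aeval_barker]
    field_simp
    ring
  | succ j ih =>
    intro z hz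
    -- Oddness turns `(-z) ^ 13 ^ 2 ^ j` into `-(z ^ 13 ^ 2 ^ j)`, so the hypothesis applies to both
    -- factors.
    have hodd : Odd (13 ^ 2 ^ j) := Odd.pow (by decide)
    have hpow : z ^ (13 ^ 2 ^ (j + 1) - 1)
        = (z ^ 13 ^ 2 ^ j) ^ (13 ^ 2 ^ j - 1) * z ^ (13 ^ 2 ^ j - 1) := by
      rw [← pow_mul, ← pow_add]
      congr 1
      obtain ⟨N, hN⟩ : ∃ N, 13 ^ 2 ^ j = N + 1 :=
        ⟨_, (Nat.sub_add_cancel (thirteen_pow_pos j)).symm⟩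
      rw [pow_succ 2 j, pow_mul, hN, Nat.add_sub_cancel]
      have : (N + 1) ^ 2 = (N + 1) * N + N + 1 := by ring
      omega
    rw [aeval_barkerIter_succ, aeval_barkerIter_succ, hodd.neg_pow, hpow, ← ih z hz,
      ← ih _ (pow_ne_zero _ hz), inv_pow]
    ring

/-- The trigonometric polynomial `|f_0| ^ 2`, written in `s = 2 cos (2 t)`, has minimum above
`13 ^ 0.86`; the proof is a sum of squares. -/
lemma barker_sq_lower_bound (s : ℝ) :
    9.079 ≤ s ^ 6 + s ^ 5 - 5 * s ^ 4 - 4 * s ^ 3 + 6 * s ^ 2 + 3 * s + 11 := by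
  nlinarith [sq_nonneg (s ^ 3 + 0.5 * s ^ 2 - 2.8741 * s - 0.4464),
    sq_nonneg (-0.7038 * s ^ 2 + 0.1656 * s + 1.3106), sq_nonneg s, sq_nonneg (s ^ 2),
    sq_nonneg (s ^ 2 + s), sq_nonneg (s ^ 2 - s), sq_nonneg (s + 1), sq_nonneg (s - 1)]

/-- The Barker autocorrelations make this `13 + ∑ (z ^ (2 * k) + z ^ (-2 * k))` over `1 ≤ k ≤ 6`,
hence a polynomial in `z ^ 2 + z ^ (-2)`. -/
lemma normSq_barker {z : ℂ} (hz : ‖z‖ = 1) :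
    ‖aeval z barker‖ ^ 2 = (2 * (z ^ 2).re) ^ 6 + (2 * (z ^ 2).re) ^ 5 - 5 * (2 * (z ^ 2).re) ^ 4
      - 4 * (2 * (z ^ 2).re) ^ 3 + 6 * (2 * (z ^ 2).re) ^ 2 + 3 * (2 * (z ^ 2).re) + 11 := by
  have hz0 : z ≠ 0 := norm_ne_zero_iff.mp (by rw [hz]; exact one_ne_zero)
  have hconj : (starRingEnd ℂ) z = z⁻¹ := (Complex.inv_eq_conj hz).symm
  have hs : ((2 * (z ^ 2).re : ℝ) : ℂ) = z ^ 2 + z⁻¹ ^ 2 := by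
    rw [← hconj, ← map_pow, Complex.add_conj]
  apply Complex.ofReal_injective
  push_cast at hs ⊢
  rw [← Complex.mul_conj', hs, aeval_barker]
  simp only [map_add, map_sub, map_pow, map_one, hconj]
  field_simp
  ring

lemma rpow_le_norm_aeval_barker {z : ℂ} (hz : ‖z‖ = 1) :
    (13 : ℝ) ^ (0.43 : ℝ) ≤ ‖aeval z barker‖ := by
  have h := barker_sq_lower_bound (2 * (z ^ 2).re)
  rw [← normSq_barker hz] at h
  refine le_of_pow_le_pow_left₀ two_ne_zero (norm_nonneg _) ?_
  refine le_trans ?_ h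
  rw [← Real.rpow_natCast, ← Real.rpow_mul (by norm_num)]
  -- The 50th power clears the exponent 0.86, leaving `13 ^ 43 ≤ 9.079 ^ 50`.
  refine le_of_pow_le_pow_left₀ (n := 50) (by norm_num) (by norm_num) ?_
  rw [← Real.rpow_natCast, ← Real.rpow_mul (by norm_num)]
  norm_num

lemma rpow_le_norm_aeval_barkerIter (j : ℕ) {z : ℂ} (hz : ‖z‖ = 1) :
    ((13 : ℝ) ^ 2 ^ j) ^ (0.43 : ℝ) ≤ ‖aeval z (barkerIter j)‖ := by
  induction j generalizing z with
  | zero => simpa [barkerIter] using rpow_le_norm_aeval_barker hz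
  | succ j ih =>
    rw [aeval_barkerIter_succ, norm_mul, pow_succ 2 j, pow_mul, sq,
      Real.mul_rpow (by positivity) (by positivity)]
    exact mul_le_mul (ih (by rw [norm_pow, hz, one_pow])) (ih hz) (by positivity) (norm_nonneg _)

/-! ### Rotations -/

lemma rotForward_coeff {f : ℤ[X]} (i : ℕ) : (rotForward f).coeff i =
    if i = 0 then f.coeff f.natDegree else if i ≤ f.natDegree then f.coeff (i - 1) else 0 := by
  rw [rotForward, coeff_add, finsetSum_coeff]
  simp only [coeff_C, coeff_C_mul_X_pow]
  cases i with
  | zero => simp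
  | succ i => simp

lemma rotBackward_coeff {f : ℤ[X]} (i : ℕ) : (rotBackward f).coeff i =
    if i < f.natDegree then f.coeff (i + 1) else if i = f.natDegree then f.coeff 0 else 0 := by
  rw [rotBackward, coeff_add, finsetSum_coeff]
  simp only [coeff_C_mul_X_pow]
  rcases lt_trichotomy i f.natDegree with h | h | h
  · simp [h, h.ne]
  · simp [h]
  · simp [h.ne', not_lt.mpr h.le]

lemma isLittlewood_of_coeff {n : ℕ} {f : ℤ[X]} (h : ∀ i ≤ n, f.coeff i = 1 ∨ f.coeff i = -1)
    (h' : ∀ i, n < i → f.coeff i = 0) : IsLittlewood n f := by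
  refine ⟨le_antisymm (natDegree_le_iff_coeff_eq_zero.mpr h') (le_natDegree_of_ne_zero ?_), h⟩
  rcases h n le_rfl with h | h <;> simp [h]

lemma IsLittlewood.rotForward {n : ℕ} {f : ℤ[X]} (hf : IsLittlewood n f) :
    IsLittlewood n (rotForward f) := by
  refine isLittlewood_of_coeff (fun i hi => ?_) fun i hi => ?_
  · rw [rotForward_coeff, hf.1]
    split_ifs
    · exact hf.2 n le_rfl
    · exact hf.2 _ (by omega)
  · rw [rotForward_coeff, hf.1, if_neg (by omega), if_neg (by omega)]

lemma IsLittlewood.rotBackward {n : ℕ} {f : ℤ[X]} (hf : IsLittlewood n f) :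
    IsLittlewood n (rotBackward f) := by
  refine isLittlewood_of_coeff (fun i hi => ?_) fun i hi => ?_
  · rw [rotBackward_coeff, hf.1]
    split_ifs
    · exact hf.2 _ (by omega)
    · exact hf.2 0 (by omega)
    · omega
  · rw [rotBackward_coeff, hf.1, if_neg (by omega), if_neg (by omega)]

/-- Both polynomials agree except in degrees 0 and `n + 1`, between which one coefficient moves. -/
lemma X_mul_sub_rotForward (f : ℤ[X]) :
    X * f - rotForward f = C (f.coeff f.natDegree) * (X ^ (f.natDegree + 1) - 1) := by
  conv_lhs => enter [1]; rw [f.as_sum_range_C_mul_X_pow, Finset.sum_range_succ, mul_add,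
    Finset.mul_sum]
  have : ∀ i, X * (C (f.coeff i) * X ^ i) = C (f.coeff i) * X ^ (i + 1) := fun i => by ring
  simp only [rotForward, this]
  ring

lemma sub_X_mul_rotBackward (f : ℤ[X]) :
    f - X * rotBackward f = -(C (f.coeff 0) * (X ^ (f.natDegree + 1) - 1)) := by
  conv_lhs => enter [1]; rw [f.as_sum_range_C_mul_X_pow, Finset.sum_range_succ']
  have : ∀ i, X * (C (f.coeff (i + 1)) * X ^ i) = C (f.coeff (i + 1)) * X ^ (i + 1) :=
    fun i => by ring
  simp only [rotBackward, mul_add, Finset.mul_sum, this]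
  ring

lemma norm_sign_mul_pow_sub_one_le {a : ℤ} (ha : a = 1 ∨ a = -1) {z : ℂ} (hz : ‖z‖ = 1) (k : ℕ) :
    ‖aeval z (C a * (X ^ k - 1) : ℤ[X])‖ ≤ 2 := by
  have h : ‖z ^ k - 1‖ ≤ 2 := by
    refine (norm_sub_le _ _).trans ?_
    rw [norm_pow, hz]
    norm_num
  rcases ha with rfl | rfl
  · simpa using h
  · simpa [norm_sub_rev] using h

lemma iterate_rotForward {n : ℕ} {f : ℤ[X]} (hf : IsLittlewood n f) (m : ℕ) :
    IsLittlewood n (rotForward^[m] f) ∧ ∀ z : ℂ, ‖z‖ = 1 →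
      ‖aeval z (X ^ m * f) - aeval z (rotForward^[m] f)‖ ≤ 2 * m := by
  induction m with
  | zero => exact ⟨hf, by simp⟩
  | succ m ih =>
    obtain ⟨hg, hb⟩ := ih
    rw [Function.iterate_succ_apply']
    set g := rotForward^[m] f
    refine ⟨hg.rotForward, fun z hz => ?_⟩
    have h1 := norm_sign_mul_pow_sub_one_le (hg.2 n le_rfl) hz (n + 1)
    have h2 := X_mul_sub_rotForward g
    rw [hg.1] at h2
    rw [← h2] at h1
    have h3 : aeval z (X ^ (m + 1) * f) - aeval z (rotForward g)
        = z * (aeval z (X ^ m * f) - aeval z g) + aeval z (X * g - rotForward g) := by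
      simp only [map_mul, map_sub, map_pow, aeval_X]
      ring
    rw [h3]
    refine (norm_add_le _ _).trans ?_
    rw [norm_mul, hz, one_mul]
    push_cast
    linarith [hb z hz]

lemma iterate_rotBackward {n : ℕ} {f : ℤ[X]} (hf : IsLittlewood n f) (m : ℕ) :
    IsLittlewood n (rotBackward^[m] f) ∧ ∀ z : ℂ, ‖z‖ = 1 →
      ‖aeval z f - aeval z (X ^ m * rotBackward^[m] f)‖ ≤ 2 * m := by
  induction m with
  | zero => exact ⟨hf, by simp⟩
  | succ m ih =>
    obtain ⟨hg, hb⟩ := ih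
    rw [Function.iterate_succ_apply']
    set g := rotBackward^[m] f
    refine ⟨hg.rotBackward, fun z hz => ?_⟩
    have h1 := norm_sign_mul_pow_sub_one_le (hg.2 0 (Nat.zero_le n)) hz (n + 1)
    have h2 := sub_X_mul_rotBackward g
    rw [hg.1] at h2
    rw [← norm_neg, ← map_neg, ← h2] at h1
    have h3 : aeval z f - aeval z (X ^ (m + 1) * rotBackward g)
        = (aeval z f - aeval z (X ^ m * g)) + z ^ m * aeval z (g - X * rotBackward g) := by
      simp only [map_mul, map_sub, map_pow, aeval_X]
      ring
    rw [h3]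
    refine (norm_add_le _ _).trans ?_
    rw [norm_mul, norm_pow, hz, one_pow, one_mul]
    push_cast
    linarith [hb z hz]

/-- Serves both directions: the power of `X` sits in `F` for forward rotations and beside `g` for
backward ones. -/
lemma realizes_of_numZerosInside {n k m : ℕ} {F g : ℤ[X]} (hg : IsLittlewood n g)
    (h : ∀ z : ℂ, ‖z‖ = 1 → ‖aeval z F - aeval z (X ^ m * g)‖ < ‖aeval z F‖)
    (hk : numZerosInside F = m + k) : Realizes g k n := by
  refine ⟨hg, numZerosOnCircle_eq_zero fun z hz h0 => ?_, ?_⟩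
  · have := h z hz
    simp [h0] at this
  · have := numZerosInside_eq_of_norm_sub_lt h
    rw [numZerosInside_X_pow_mul hg.ne_zero, hk] at this
    omega

/-- If `|f| > 2 m` on the unit circle, then `m` forward rotations add `m` zeros in the disk. -/
lemma realizes_iterate_rotForward {n m : ℕ} {f : ℤ[X]} (hf : IsLittlewood n f)
    (h : ∀ z : ℂ, ‖z‖ = 1 → 2 * (m : ℝ) < ‖aeval z f‖) :
    Realizes (rotForward^[m] f) (m + numZerosInside f) n := by
  obtain ⟨hg, hb⟩ := iterate_rotForward hf m
  refine realizes_of_numZerosInside (m := 0) (F := X ^ m * f) hg (fun z hz => ?_) ?_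
  · rw [pow_zero, one_mul]
    refine (hb z hz).trans_lt ?_
    simpa [hz] using h z hz
  · rw [numZerosInside_X_pow_mul hf.ne_zero, zero_add]

/-- If `|f| > 2 m` on the unit circle, then `m` backward rotations remove `m` zeros from the
disk. -/
lemma realizes_iterate_rotBackward {n m k : ℕ} {f : ℤ[X]} (hf : IsLittlewood n f)
    (h : ∀ z : ℂ, ‖z‖ = 1 → 2 * (m : ℝ) < ‖aeval z f‖) (hk : numZerosInside f = m + k) :
    Realizes (rotBackward^[m] f) k n := by
  obtain ⟨hg, hb⟩ := iterate_rotBackward hf m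
  exact realizes_of_numZerosInside hg (fun z hz => (hb z hz).trans_lt (h z hz)) hk

end LittlewoodRotation

end

theorem theorem5p7 (j n : ℕ) (hn : n = 13 ^ (2 ^ j) - 1) :
    LittlewoodRotation.IsLittlewood n (LittlewoodRotation.barkerIter j) ∧
    ∀ k : ℕ, |(k : ℝ) - (n : ℝ) / 2| ≤ (⌈(n : ℝ) ^ (0.43 : ℝ) / 2⌉ : ℝ) - 1 →
      LittlewoodRotation.LittlewoodAdmissible k n ∧
      ∃ m : ℤ, LittlewoodRotation.Realizes
        (LittlewoodRotation.rotate (LittlewoodRotation.barkerIter j) m) k n := by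
  open LittlewoodRotation in
  have hL : IsLittlewood n (barkerIter j) := hn ▸ isLittlewood_barkerIter j
  refine ⟨hL, fun k hk => ?_⟩
  have hpos := thirteen_pow_pos j
  have hn12 : 12 ≤ n := by
    have := Nat.pow_le_pow_right (show 0 < 13 by norm_num) (Nat.one_le_two_pow (n := j))
    omega
  have hn1 : (1 : ℝ) < n := by exact_mod_cast (by omega : 1 < n)
  -- `⌈x⌉ - 1 < x` supplies the strict inequality that Rouché needs.
  have hdist : 2 * |(k : ℝ) - (n : ℝ) / 2| < (n : ℝ) ^ (0.43 : ℝ) := by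
    linarith [Int.ceil_lt_add_one ((n : ℝ) ^ (0.43 : ℝ) / 2)]
  have hbound : ∀ z : ℂ, ‖z‖ = 1 → (n : ℝ) ^ (0.43 : ℝ) ≤ ‖aeval z (barkerIter j)‖ := by
    intro z hz
    refine le_trans (Real.rpow_le_rpow (by positivity) ?_ (by norm_num))
      (rpow_le_norm_aeval_barkerIter j hz)
    have : n ≤ 13 ^ 2 ^ j := by omega
    exact_mod_cast this
  have hne : ∀ z : ℂ, ‖z‖ = 1 → aeval z (barkerIter j) ≠ 0 := fun z hz =>
    norm_pos_iff.mp ((Real.rpow_pos_of_pos (by linarith) _).trans_le (hbound z hz))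
  have hhalf : 2 * numZerosInside (barkerIter j) = n := by
    refine two_mul_numZerosInside hL.1 (hn ▸ isSkewReciprocal_barkerIter j) ?_ hne
    rcases hL.2 0 (Nat.zero_le n) with h | h <;> simp [h]
  have hnr : (n : ℝ) = 2 * (numZerosInside (barkerIter j) : ℝ) := by exact_mod_cast hhalf.symm
  set N := numZerosInside (barkerIter j)
  have hreal : ∃ m : ℤ, Realizes (rotate (barkerIter j) m) k n := by
    rcases le_or_gt N k with hle | hlt
    · obtain ⟨m, rfl⟩ := Nat.exists_eq_add_of_le' hle
      refine ⟨Int.ofNat m, realizes_iterate_rotForward hL fun z hz => ?_⟩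
      refine lt_of_lt_of_le ?_ (hbound z hz)
      push_cast at hdist
      linarith [le_abs_self ((m : ℝ) + N - n / 2)]
    · obtain ⟨m, hm⟩ := Nat.exists_eq_add_of_lt hlt
      -- `Int.negSucc m` encodes `m + 1` backward steps, matching `N = k + m + 1`.
      refine ⟨Int.negSucc m, realizes_iterate_rotBackward hL (m := m + 1) (fun z hz => ?_) ?_⟩
      · refine lt_of_lt_of_le ?_ (hbound z hz)
        have : (N : ℝ) = k + m + 1 := by exact_mod_cast hm
        push_cast
        linarith [neg_le_abs ((k : ℝ) - n / 2)]
      · change N = _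
        omega
  refine ⟨⟨?_, _, hreal.choose_spec⟩, hreal⟩
  -- Now `|k - n / 2| < n / 2`, which forces `0 < k < n`.
  have hlt : (n : ℝ) ^ (0.43 : ℝ) < n := by
    simpa using Real.rpow_lt_rpow_of_exponent_lt hn1 (show (0.43 : ℝ) < 1 by norm_num)
  constructor
  · have : (0 : ℝ) < k := by linarith [neg_le_abs ((k : ℝ) - n / 2)]
    exact_mod_cast this
  · have : (k : ℝ) < n := by linarith [le_abs_self ((k : ℝ) - n / 2)]
    exact_mod_cast this
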